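/- Let $d\in\mathbb N=\{1,2,\dots\}$, let $\|\cdot\|$ and $\langle\cdot,\cdot\rangle$ be the standard Euclidean norm and scalar product on $\mathbb R^d$, let $\kappa,\mathcal K\in(0,\infty)$, and let $\mathcal L\in C^2(\mathbb R^d,\mathbb R)$ satisfy for all $\theta,\psi\in\mathbb R^d$ that $$\|\nabla\mathcal L(\theta)-\nabla\mathcal L(\psi)\|\le\mathcal K\|\theta-\psi\|\qquad\text{and}\qquad\langle\theta,\nabla\mathcal L(\theta)\rangle\ge\kappa\|\theta\|^2 .$$ Let $\alpha,\beta\in(0,1)$ and $\gamma,\varepsilon\in(0,\infty)$ satisfy $$\alpha=\Bigl(\frac{1-\gamma\varepsilon^{-1}\kappa}{1+\gamma\varepsilon^{-1}\kappa}\Bigr)^2,\qquad \beta>\alpha^2,\qquad \gamma\le\frac{\alpha\varepsilon}{\mathcal K}.$$ Let $\Theta,\mathbf m,\mathbb M\colon\mathbb N_0\to\mathbb R^d$ (with arbitrary starting values $\Theta_0,\mathbf m_0,\mathbb M_0\in\mathbb R^d$) satisfy the Adam recursion, that is, for all $n\in\mathbb N$ and all components $i\in\{1,\dots,d\}$, $$\mathbf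 m_n^i=\alpha\,\mathbf m_{n-1}^i+(1-\alpha)\,(\nabla\mathcal L(\Theta_{n-1}))^i,\qquad \mathbb M_n^i=\beta\,\mathbb M_{n-1}^i+(1-\beta)\,\bigl[(\nabla\mathcal L(\Theta_{n-1}))^i\bigr]^2,$$ $$\Theta_n^i=\Theta_{n-1}^i-\gamma(1-\alpha^n)^{-1}\Bigl(\varepsilon+(1-\beta^n)^{-1/2}\sqrt{\mathbb M_n^i}\Bigr)^{-1}\mathbf m_n^i ,$$ where $\sqrt x$ is read as $0$ for $x<0$ (which never occurs if $\mathbb M_0\in[0,\infty)^d$). Then for every $\delta>0$ there exists $C>0$ such that for all $n\in\mathbb N$ $$\|\Theta_n\|\le C\,(\sqrt\alpha+\delta)^n .$$ -/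

import Mathlib

/-- The sequences `Θ` (iterates), `m` (first moments) and `M` (second moments) in `ℝ^d` follow the
bias-corrected Adam recursion for the objective `L` with momentum parameter `α`, second moment
parameter `β`, learning rate `γ` and regularization `ε`; the starting values `Θ 0`, `m 0`, `M 0` are
arbitrary. All products, squares, square roots and inverses of vectors are componentwise. With `M 0` componentwise nonnegative every `M n` is so; the
square root of a negative component, possible only for other starting values, is read as `0`. -/
structure IsAdamProcess {d : ℕ} (L : EuclideanSpace ℝ (Fin d) → ℝ) (α β γ ε : ℝ)
    (Θ m M : ℕ → EuclideanSpace ℝ (Fin d)) : Prop where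
  first_moment : ∀ n : ℕ, m (n + 1) = α • m n + (1 - α) • gradient L (Θ n)
  second_moment : ∀ (n : ℕ) (i : Fin d),
    M (n + 1) i = β * M n i + (1 - β) * (gradient L (Θ n) i) ^ 2
  iterate : ∀ (n : ℕ) (i : Fin d),
    Θ (n + 1) i = Θ n i
      - γ * (1 - α ^ (n + 1))⁻¹
        * (ε + (√(1 - β ^ (n + 1)))⁻¹ * √(M (n + 1) i))⁻¹ * m (n + 1) i

/-! Put c = γ/ε and let H be the Hessian of `L` at the origin. Once `Θ` tends to 0, the gradients
and hence `M` tend to 0, the effective step sizes tend to c, and eliminating `m` turns Adam into a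
perturbed heavy ball recursion Θ (n+2) = P Θ (n+1) - α Θ n + o(‖Θ (n+1)‖ + ‖Θ n‖) with P = (1+α) -
(1-α) c H. For an eigenvalue p of P, both roots of z² - p z + α have modulus √α when |p| ≤ 2√α. The
choice of α guarantees this bound (`abs_inner_momentum_le`), and a quadratic energy absorbs the
perturbation at the price of δ (`exists_norm_le_pow_of_momentum_recursion`).

That `Θ` tends to 0 (`IsAdamProcess.tendsto_zero`) follows from the Lyapunov function L(Θ n) + const
· ∑ step · m². It eventually decreases: β > α² keeps the step sizes from growing by more than a
factor 1/α, and γ ≤ αε/K eventually makes K · step ≤ 1. -/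

/-! ### Gradient estimates and the Hessian at the minimizer. -/

section Gradient

variable {E : Type*} [NormedAddCommGroup E] [InnerProductSpace ℝ E] [CompleteSpace E]

theorem hasDerivAt_comp_line {L : E → ℝ} (hL : Differentiable ℝ L) (x v : E) (t : ℝ) :
    HasDerivAt (fun s : ℝ => L (x + s • v)) (inner ℝ (gradient L (x + t • v)) v) t := by
  have h1 := (hL (x + t • v)).hasGradientAt.hasFDerivAt
  have h2 : HasDerivAt (fun s : ℝ => x + s • v) v t := by
    simpa using ((hasDerivAt_id t).smul_const v).const_add x
  exact (h1.comp_hasDerivAt t h2).congr_deriv (by simp)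

theorem le_add_inner_gradient_add_sq {L : E → ℝ} (hL : Differentiable ℝ L) {K : ℝ}
    (hLip : ∀ x y : E, ‖gradient L x - gradient L y‖ ≤ K * ‖x - y‖) (x v : E) :
    L (x + v) ≤ L x + inner ℝ (gradient L x) v + K / 2 * ‖v‖ ^ 2 := by
  have hd : ∀ t : ℝ, HasDerivAt
      (fun s : ℝ => L (x + s • v) - (s * inner ℝ (gradient L x) v + s ^ 2 * (K / 2 * ‖v‖ ^ 2)))
      (inner ℝ (gradient L (x + t • v)) v
        - (inner ℝ (gradient L x) v + 2 * t * (K / 2 * ‖v‖ ^ 2))) t := by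
    intro t
    have h1 := (hasDerivAt_id t).mul_const (inner ℝ (gradient L x) v)
    have h2 := (hasDerivAt_pow 2 t).mul_const (K / 2 * ‖v‖ ^ 2)
    exact ((hasDerivAt_comp_line hL x v t).sub (h1.add h2)).congr_deriv (by simp)
  have hanti := antitoneOn_of_hasDerivWithinAt_nonpos (convex_Icc (0 : ℝ) 1)
    (fun t _ => (hd t).continuousAt.continuousWithinAt)
    (fun t _ => (hd t).hasDerivWithinAt) (by
      intro t ht
      rw [interior_Icc] at ht
      have h1 : inner ℝ (gradient L (x + t • v) - gradient L x) v
          ≤ K * ‖x + t • v - x‖ * ‖v‖ :=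
        (real_inner_le_norm _ _).trans (mul_le_mul_of_nonneg_right (hLip _ _) (norm_nonneg _))
      rw [inner_sub_left, add_sub_cancel_left, norm_smul, Real.norm_of_nonneg ht.1.le] at h1
      nlinarith)
  have := hanti (Set.left_mem_Icc.2 zero_le_one) (Set.right_mem_Icc.2 zero_le_one) zero_le_one
  simp only [one_smul, zero_smul, add_zero] at this
  linarith

/-- Coercivity bounds the radial derivative at `t • v` below by κ t ‖v‖²; integrate over [0, 1].
This later bounds the iterates through the Lyapunov function. -/
theorem add_sq_le_of_inner_gradient_ge {L : E → ℝ} (hL : Differentiable ℝ L) {κ : ℝ}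
    (hcoer : ∀ x : E, inner ℝ x (gradient L x) ≥ κ * ‖x‖ ^ 2) (v : E) :
    L 0 + κ / 2 * ‖v‖ ^ 2 ≤ L v := by
  have hd : ∀ t : ℝ, HasDerivAt
      (fun s : ℝ => L (0 + s • v) - s ^ 2 * (κ / 2 * ‖v‖ ^ 2))
      (inner ℝ (gradient L (0 + t • v)) v - 2 * t * (κ / 2 * ‖v‖ ^ 2)) t := by
    intro t
    have h2 := (hasDerivAt_pow 2 t).mul_const (κ / 2 * ‖v‖ ^ 2)
    exact ((hasDerivAt_comp_line hL 0 v t).sub h2).congr_deriv (by simp)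
  have hmono := monotoneOn_of_hasDerivWithinAt_nonneg (convex_Icc (0 : ℝ) 1)
    (fun t _ => (hd t).continuousAt.continuousWithinAt)
    (fun t _ => (hd t).hasDerivWithinAt) (by
      intro t ht
      rw [interior_Icc] at ht
      have h1 := hcoer (t • v)
      rw [inner_smul_left, norm_smul, Real.norm_of_nonneg ht.1.le, real_inner_comm] at h1
      simp only [conj_trivial] at h1
      rw [zero_add]
      have h2 : t * (κ * t * ‖v‖ ^ 2) ≤ t * inner ℝ (gradient L (t • v)) v := by nlinarith
      have := le_of_mul_le_mul_left h2 ht.1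
      linarith)
  have := hmono (Set.left_mem_Icc.2 zero_le_one) (Set.right_mem_Icc.2 zero_le_one) zero_le_one
  simp at this
  linarith

theorem mul_norm_le_norm_gradient {L : E → ℝ} {κ : ℝ}
    (hcoer : ∀ x : E, inner ℝ x (gradient L x) ≥ κ * ‖x‖ ^ 2) (x : E) :
    κ * ‖x‖ ≤ ‖gradient L x‖ := by
  rcases eq_or_ne x 0 with rfl | hx
  · simp
  · have h := (hcoer x).le.trans (real_inner_le_norm _ _)
    have hx' := norm_pos_iff.2 hx
    exact le_of_mul_le_mul_left (by nlinarith) hx'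

theorem contDiff_gradient {L : E → ℝ} (hL : ContDiff ℝ 2 L) : ContDiff ℝ 1 (gradient L) :=
  (InnerProductSpace.toDual ℝ E).symm.contDiff.comp (hL.fderiv_right (m := 1) (by norm_num))

/-- Coercivity at `t • v`, divided by t, gives in the limit t → 0+ a nonnegative pairing of v with
the gradient at 0; test with v minus that gradient. -/
theorem gradient_zero_of_inner_gradient_ge {L : E → ℝ} (hL : ContDiff ℝ 2 L) {κ : ℝ}
    (hcoer : ∀ x : E, inner ℝ x (gradient L x) ≥ κ * ‖x‖ ^ 2) : gradient L 0 = 0 := by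
  have hc := (contDiff_gradient hL).continuous
  have h : ∀ v : E, 0 ≤ inner ℝ v (gradient L 0) := by
    intro v
    have h1 : Filter.Tendsto (fun t : ℝ => inner ℝ v (gradient L (t • v)) - κ * t * ‖v‖ ^ 2)
        (nhdsWithin 0 (Set.Ioi 0)) (nhds (inner ℝ v (gradient L 0))) := by
      have : Continuous (fun t : ℝ => inner ℝ v (gradient L (t • v)) - κ * t * ‖v‖ ^ 2) := by
        fun_prop
      simpa using (this.tendsto 0).mono_left nhdsWithin_le_nhds
    refine ge_of_tendsto h1 ?_
    filter_upwards [self_mem_nhdsWithin] with t ht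
    have ht : 0 < t := ht
    have h2 := hcoer (t • v)
    rw [inner_smul_left, norm_smul, Real.norm_of_nonneg ht.le] at h2
    simp only [conj_trivial] at h2
    have := le_of_mul_le_mul_left
      (show t * (κ * t * ‖v‖ ^ 2) ≤ t * inner ℝ v (gradient L (t • v)) by nlinarith) ht
    linarith
  have h1 := h (-gradient L 0)
  rw [inner_neg_left, real_inner_self_eq_norm_sq] at h1
  exact norm_eq_zero.1 (by nlinarith [norm_nonneg (gradient L 0)])

theorem exists_symmetric_hasFDerivAt_gradient {L : E → ℝ} (hL : ContDiff ℝ 2 L) (x : E) :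
    ∃ H : E →L[ℝ] E, HasFDerivAt (gradient L) H x ∧
      ∀ v w : E, inner ℝ (H v) w = inner ℝ v (H w) := by
  have h1 := ((contDiff_gradient hL).differentiable (by norm_num) x).hasFDerivAt
  refine ⟨_, h1, fun v w => ?_⟩
  have h2 := (hL.fderiv_right (m := 1) (by norm_num)).differentiable (by norm_num) x |>.hasFDerivAt
  have key : ∀ v w : E, fderiv ℝ (fderiv ℝ L) x v w = inner ℝ (fderiv ℝ (gradient L) x v) w := by
    intro v w
    have h3 := h1.inner ℝ (hasFDerivAt_const w x)
    have h4 := h2.clm_apply (hasFDerivAt_const w x)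
    have h5 : (fun y => fderiv ℝ L y w) = fun y => inner ℝ (gradient L y) w := by
      ext y; simp
    rw [h5] at h4
    simpa using DFunLike.congr_fun (h4.unique h3) v
  have hs : IsSymmSndFDerivAt ℝ L x := hL.contDiffAt.isSymmSndFDerivAt (by simp)
  rw [← key, hs v w, key, real_inner_comm]

end Gradient

theorem mul_sq_le_inner_of_hasFDerivAt {E : Type*} [NormedAddCommGroup E]
    [InnerProductSpace ℝ E] {g : E → E} {H : E →L[ℝ] E} (hg : HasFDerivAt g H 0)
    (h0 : g 0 = 0) {κ : ℝ} (hcoer : ∀ x : E, inner ℝ x (g x) ≥ κ * ‖x‖ ^ 2) (v : E) :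
    κ * ‖v‖ ^ 2 ≤ inner ℝ v (H v) := by
  have h1 : HasDerivAt (fun t : ℝ => g (t • v)) (H v) 0 := by
    have h2 : HasDerivAt (fun t : ℝ => t • v) v 0 := by
      simpa using (hasDerivAt_id (0 : ℝ)).smul_const v
    have h3 : HasFDerivAt g H ((0 : ℝ) • v) := by simpa using hg
    exact h3.comp_hasDerivAt 0 h2
  have h2 := h1.tendsto_slope_zero_right
  have h3 := (tendsto_const_nhds (x := v)).inner (𝕜 := ℝ) h2
  refine ge_of_tendsto h3 ?_
  filter_upwards [self_mem_nhdsWithin] with t ht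
  have ht : 0 < t := ht
  have h4 := hcoer (t • v)
  rw [inner_smul_left, norm_smul, Real.norm_of_nonneg ht.le] at h4
  simp only [conj_trivial] at h4
  simp only [zero_add, zero_smul, h0, sub_zero, inner_smul_right]
  rw [inv_mul_eq_div, le_div_iff₀ ht]
  exact le_of_mul_le_mul_left (show t * (κ * ‖v‖ ^ 2 * t) ≤ t * inner ℝ v (g (t • v)) by
    nlinarith) ht

/-! ### Perturbed heavy ball recursions. -/

section HeavyBall

variable {E : Type*} [NormedAddCommGroup E] [InnerProductSpace ℝ E]

/-- Polarization: for a symmetric operator the numerical radius controls the norm. -/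
theorem abs_inner_le_of_symmetric {P : E →L[ℝ] E}
    (hsymm : ∀ v w : E, inner ℝ (P v) w = inner ℝ v (P w)) {b : ℝ}
    (hP : ∀ v : E, |inner ℝ (P v) v| ≤ b * ‖v‖ ^ 2) (x y : E) :
    |inner ℝ (P x) y| ≤ b * ‖x‖ * ‖y‖ := by
  have key : ∀ x y : E, inner ℝ (P x) y ≤ b / 2 * (‖x‖ ^ 2 + ‖y‖ ^ 2) := by
    intro x y
    have h1 := (abs_le.1 (hP (x + y))).2
    have h2 := (abs_le.1 (hP (x - y))).1
    have h3 := parallelogram_law_with_norm ℝ x y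
    have h4 : inner ℝ (P y) x = inner ℝ (P x) y := by rw [hsymm, real_inner_comm]
    simp only [map_add, map_sub, inner_add_left, inner_add_right, inner_sub_left,
      inner_sub_right] at h1 h2
    have h5 : b * (‖x + y‖ ^ 2 + ‖x - y‖ ^ 2) = b * (2 * (‖x‖ ^ 2 + ‖y‖ ^ 2)) := by
      congr 1
    linarith
  have key2 : ∀ x y : E, inner ℝ (P x) y ≤ b * ‖x‖ * ‖y‖ := by
    intro x y
    rcases eq_or_ne x 0 with rfl | hx
    · simp
    rcases eq_or_ne y 0 with rfl | hy
    · simp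
    have hx' := norm_pos_iff.2 hx
    have hy' := norm_pos_iff.2 hy
    -- Rescaling to equal norms turns the arithmetic mean in `key` into a product.
    have h := key (‖y‖ • x) (‖x‖ • y)
    rw [map_smul, inner_smul_left, inner_smul_right, norm_smul, norm_smul, norm_norm,
      norm_norm] at h
    simp only [conj_trivial] at h
    refine le_of_mul_le_mul_left (?_ : ‖x‖ * ‖y‖ * _ ≤ _) (mul_pos hx' hy')
    nlinarith
  refine abs_le.2 ⟨?_, key2 x y⟩
  have := key2 x (-y)
  rw [inner_neg_right, norm_neg] at this
  linarith

theorem quadratic_form_nonneg {P : E →L[ℝ] E} {τ : ℝ}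
    (hP : ∀ x y : E, |inner ℝ (P x) y| ≤ 2 * τ * ‖x‖ * ‖y‖) {A B C : ℝ} (hA : 0 ≤ A)
    (hB : 0 ≤ B) (hC : 0 ≤ C) (h : (τ * B) ^ 2 ≤ A * C) (x y : E) :
    0 ≤ A * ‖x‖ ^ 2 - B * inner ℝ (P x) y + C * ‖y‖ ^ 2 := by
  have h1 := mul_le_mul_of_nonneg_left (abs_le.1 (hP x y)).2 hB
  have h2 : 2 * (τ * B) * (‖x‖ * ‖y‖) ≤ A * ‖x‖ ^ 2 + C * ‖y‖ ^ 2 := by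
    refine abs_le_of_sq_le_sq' ?_ (by positivity) |>.2
    have h3 := mul_le_mul_of_nonneg_right h (sq_nonneg (‖x‖ * ‖y‖))
    nlinarith [sq_nonneg (A * ‖x‖ ^ 2 - C * ‖y‖ ^ 2)]
  linarith

/-- A quadratic form along which the momentum iteration `x, y ↦ P x - τ ^ 2 • y, x` contracts. -/
noncomputable def momentumEnergy (P : E →L[ℝ] E) (a : ℝ) (x y : E) : ℝ :=
  ‖x‖ ^ 2 - inner ℝ (P x) y + a * ‖y‖ ^ 2

/-- With a = τ² the energy is multiplied by exactly τ² in each step, but it may degenerate when P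
has norm 2τ. The shift t makes it definite, and s pays for the shift. -/
theorem momentumEnergy_step_le {P : E →L[ℝ] E} {τ : ℝ} (hτ : 0 < τ)
    (hsymm : ∀ v w : E, inner ℝ (P v) w = inner ℝ v (P w))
    (hP : ∀ x y : E, |inner ℝ (P x) y| ≤ 2 * τ * ‖x‖ * ‖y‖) {s t : ℝ} (hs : 0 < s) (ht : 0 < t)
    (hst : τ ^ 2 * t ≤ s ^ 2) (x y : E) :
    momentumEnergy P (τ ^ 2 + t) (P x - τ ^ 2 • y) x
      ≤ (τ ^ 2 + t + s) * momentumEnergy P (τ ^ 2 + t) x y := by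
  -- This form is the right side minus the left side; its discriminant condition reduces to τ² t² ≤
  -- s t² + s² t.
  have h := quadratic_form_nonneg hP (A := s) (B := t + s)
    (C := (τ ^ 2 + t + s) * (τ ^ 2 + t) - (τ ^ 2) ^ 2) hs.le (by positivity)
    (by nlinarith [mul_pos hs ht, sq_nonneg τ, mul_pos (pow_pos hτ 2) ht,
      mul_pos (pow_pos hτ 2) hs, sq_nonneg t])
    (by nlinarith [mul_le_mul_of_nonneg_right hst ht.le, mul_pos hs (pow_pos ht 2)]) x y
  have e : momentumEnergy P (τ ^ 2 + t) (P x - τ ^ 2 • y) x =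
      (τ ^ 2) ^ 2 * ‖y‖ ^ 2 - τ ^ 2 * inner ℝ (P x) y + (τ ^ 2 + t) * ‖x‖ ^ 2 := by
    unfold momentumEnergy
    rw [hsymm, inner_sub_left, norm_sub_sq_real, inner_smul_left, inner_smul_right, norm_smul,
      real_inner_self_eq_norm_sq, real_inner_comm y (P x)]
    simp only [conj_trivial, norm_pow, Real.norm_of_nonneg hτ.le]
    ring
  rw [e]
  unfold momentumEnergy
  nlinarith

theorem mul_le_momentumEnergy {P : E →L[ℝ] E} {τ : ℝ} (hτ : 0 < τ)
    (hP : ∀ x y : E, |inner ℝ (P x) y| ≤ 2 * τ * ‖x‖ * ‖y‖) {t : ℝ} (ht : 0 < t) (x y : E) :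
    t / (1 + τ ^ 2 + t) * (‖x‖ ^ 2 + ‖y‖ ^ 2) ≤ momentumEnergy P (τ ^ 2 + t) x y := by
  set μ := t / (1 + τ ^ 2 + t) with hμ
  have hden : 0 < 1 + τ ^ 2 + t := by positivity
  have hμ0 : 0 < μ := by positivity
  have hμt : μ * (1 + τ ^ 2 + t) = t := by rw [hμ]; field_simp
  -- By the choice of μ, (1 - μ)(τ² + t - μ) = τ² + μ².
  have h := quadratic_form_nonneg hP (A := 1 - μ) (B := 1) (C := τ ^ 2 + t - μ)
    (by nlinarith [mul_pos hμ0 ht, sq_nonneg τ, mul_pos hμ0 (pow_pos hτ 2)]) zero_le_one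
    (by nlinarith [mul_pos hμ0 ht, sq_nonneg τ, mul_pos hμ0 (pow_pos hτ 2)])
    (by nlinarith) x y
  unfold momentumEnergy
  linarith

theorem momentumEnergy_add_le {P : E →L[ℝ] E} {τ : ℝ} (hτ : 0 < τ)
    (hP : ∀ x y : E, |inner ℝ (P x) y| ≤ 2 * τ * ‖x‖ * ‖y‖) {a η : ℝ} (hη : 0 ≤ η) (hη1 : η ≤ 1)
    {x y e : E} (he : ‖e‖ ≤ η * (‖x‖ + ‖y‖)) :
    momentumEnergy P a (P x - τ ^ 2 • y + e) x ≤ momentumEnergy P a (P x - τ ^ 2 • y) x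
      + η * (2 * (2 * (2 * τ + τ ^ 2) + 1 + 2 * τ)) * (‖x‖ ^ 2 + ‖y‖ ^ 2) := by
  have hPx : ‖P x‖ ≤ 2 * τ * ‖x‖ := by
    have := (abs_le.1 (hP x (P x))).2
    rw [real_inner_self_eq_norm_sq] at this
    rcases eq_or_ne (‖P x‖) 0 with h0 | h0
    · rw [h0]; positivity
    · have h0 := lt_of_le_of_ne (norm_nonneg _) h0.symm
      exact le_of_mul_le_mul_right (by nlinarith) h0
  have hx := norm_nonneg x
  have hy := norm_nonneg y
  set S := ‖x‖ + ‖y‖ with hS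
  have hS0 : 0 ≤ S := by positivity
  have hz : ‖P x - τ ^ 2 • y‖ ≤ (2 * τ + τ ^ 2) * S := by
    refine (norm_sub_le _ _).trans ?_
    rw [norm_smul, norm_pow, Real.norm_of_nonneg hτ.le, hS]
    nlinarith [mul_nonneg hτ.le hy, mul_nonneg (sq_nonneg τ) hx]
  have h1 : inner ℝ (P x - τ ^ 2 • y) e ≤ (2 * τ + τ ^ 2) * S * (η * S) :=
    (real_inner_le_norm _ _).trans (mul_le_mul hz he (norm_nonneg _) (by positivity))
  have h2 : ‖e‖ ^ 2 ≤ η * S ^ 2 := by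
    have := pow_le_pow_left₀ (norm_nonneg e) he 2
    nlinarith [mul_nonneg hη (sq_nonneg S)]
  have h3 : -inner ℝ (P e) x ≤ 2 * τ * (η * S) * S := by
    refine (neg_le_abs _).trans ((hP e x).trans ?_)
    gcongr
    linarith
  have h4 : S ^ 2 ≤ 2 * (‖x‖ ^ 2 + ‖y‖ ^ 2) := by
    rw [hS]; nlinarith [sq_nonneg (‖x‖ - ‖y‖)]
  have h5 := mul_le_mul_of_nonneg_left h4
    (show 0 ≤ η * (2 * (2 * τ + τ ^ 2) + 1 + 2 * τ) by positivity)
  unfold momentumEnergy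
  rw [map_add, inner_add_left, norm_add_sq_real]
  nlinarith

-- The gap between τ² and (τ + δ)² is split into three parts s: one each for the shift t, the linear
-- step and the perturbation.
open Filter in
theorem exists_norm_le_pow_of_momentum_recursion {P : E →L[ℝ] E} {τ : ℝ} (hτ : 0 < τ)
    (hsymm : ∀ v w : E, inner ℝ (P v) w = inner ℝ v (P w))
    (hPb : ∀ v : E, |inner ℝ (P v) v| ≤ 2 * τ * ‖v‖ ^ 2) {x : ℕ → E}
    (hx : ∀ η : ℝ, 0 < η → ∀ᶠ n in atTop,
      ‖x (n + 2) - (P (x (n + 1)) - τ ^ 2 • x n)‖ ≤ η * (‖x (n + 1)‖ + ‖x n‖))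
    {δ : ℝ} (hδ : 0 < δ) :
    ∃ C : ℝ, 0 < C ∧ ∀ n : ℕ, ‖x n‖ ≤ C * (τ + δ) ^ n := by
  have hP := abs_inner_le_of_symmetric hsymm hPb
  obtain ⟨s, hs, hs3⟩ : ∃ s : ℝ, 0 < s ∧ τ ^ 2 + 3 * s = (τ + δ) ^ 2 :=
    ⟨((τ + δ) ^ 2 - τ ^ 2) / 3, by nlinarith [mul_pos hτ hδ], by ring⟩
  obtain ⟨t, ht, hts, hst⟩ : ∃ t : ℝ, 0 < t ∧ t ≤ s ∧ τ ^ 2 * t ≤ s ^ 2 := by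
    refine ⟨min s (s ^ 2 / τ ^ 2), by positivity, min_le_left _ _, ?_⟩
    calc τ ^ 2 * min s (s ^ 2 / τ ^ 2) ≤ τ ^ 2 * (s ^ 2 / τ ^ 2) := by
          gcongr; exact min_le_right _ _
      _ = s ^ 2 := by field_simp
  set μ := t / (1 + τ ^ 2 + t) with hμ
  have hμ0 : 0 < μ := by positivity
  set c := 2 * (2 * (2 * τ + τ ^ 2) + 1 + 2 * τ) with hc
  have hc0 : 0 < c := by positivity
  set V : ℕ → ℝ := fun n => momentumEnergy P (τ ^ 2 + t) (x (n + 1)) (x n) with hV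
  have hVlow : ∀ n, μ * (‖x (n + 1)‖ ^ 2 + ‖x n‖ ^ 2) ≤ V n := fun n =>
    mul_le_momentumEnergy hτ hP ht _ _
  have hV0 : ∀ n, 0 ≤ V n := fun n => le_trans (by positivity) (hVlow n)
  set η := min 1 (s * μ / c) with hη
  have hη0 : 0 < η := by positivity
  have hηc : η * c ≤ s * μ := by
    calc η * c ≤ s * μ / c * c := by gcongr; exact min_le_right _ _
      _ = s * μ := by field_simp
  obtain ⟨N, hN⟩ := eventually_atTop.1 (hx η hη0)
  have hstep : ∀ n ≥ N, V (n + 1) ≤ (τ + δ) ^ 2 * V n := by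
    intro n hn
    have h1 := momentumEnergy_add_le hτ hP (a := τ ^ 2 + t) hη0.le (min_le_left _ _) (hN n hn)
    rw [add_sub_cancel] at h1
    have h2 := momentumEnergy_step_le hτ hsymm hP hs ht hst (x (n + 1)) (x n)
    have h3 : η * c * (‖x (n + 1)‖ ^ 2 + ‖x n‖ ^ 2) ≤ s * V n := by
      calc η * c * (‖x (n + 1)‖ ^ 2 + ‖x n‖ ^ 2)
          ≤ s * μ * (‖x (n + 1)‖ ^ 2 + ‖x n‖ ^ 2) := by gcongr
        _ ≤ s * V n := by rw [mul_assoc]; gcongr; exact hVlow n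
    have h4 : t * V n ≤ s * V n := mul_le_mul_of_nonneg_right hts (hV0 n)
    rw [← hs3]
    change V (n + 1) ≤ _ at h1
    change _ ≤ _ * V n at h2
    linarith
  have hτδ : 0 < τ + δ := by positivity
  set D := V N / ((τ + δ) ^ 2) ^ N with hD
  have hD0 : 0 ≤ D := div_nonneg (hV0 N) (by positivity)
  have hbound : ∀ n ≥ N, V n ≤ D * ((τ + δ) ^ 2) ^ n := by
    intro n hn
    induction n, hn using Nat.le_induction with
    | base => rw [hD]; field_simp; exact le_rfl
    | succ n hn ih =>
      calc V (n + 1) ≤ (τ + δ) ^ 2 * V n := hstep n hn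
        _ ≤ (τ + δ) ^ 2 * (D * ((τ + δ) ^ 2) ^ n) := by gcongr
        _ = _ := by ring
  have hO : x =O[atTop] fun n => (τ + δ) ^ n := by
    refine Asymptotics.IsBigO.of_bound (√(D / μ)) ?_
    filter_upwards [eventually_ge_atTop N] with n hn
    rw [Real.norm_of_nonneg (by positivity)]
    refine abs_le_of_sq_le_sq' ?_ (by positivity) |>.2
    rw [mul_pow, Real.sq_sqrt (by positivity), ← pow_mul, mul_comm n 2, pow_mul,
      div_mul_eq_mul_div, le_div_iff₀ hμ0]
    nlinarith [hVlow n, hbound n hn, mul_nonneg hμ0.le (sq_nonneg ‖x (n + 1)‖)]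
  -- Since (τ + δ)^n never vanishes, enlarging the constant covers the finitely many initial
  -- indices.
  obtain ⟨C, hC, h⟩ := Asymptotics.bound_of_isBigO_nat_atTop hO
  refine ⟨C, hC, fun n => ?_⟩
  have := h (x := n) (by positivity)
  rwa [Real.norm_of_nonneg (by positivity)] at this

end HeavyBall

/-! ### Effective step sizes and decrease of the Lyapunov function. -/

section Adam

open Filter Topology

theorem tendsto_zero_of_affine_recursion {β : ℝ} (hβ0 : 0 ≤ β) (hβ1 : β < 1) {u w : ℕ → ℝ}
    (hu : ∀ n, u (n + 1) = β * u n + w n) (hw : Tendsto w atTop (𝓝 0)) :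
    Tendsto u atTop (𝓝 0) := by
  rw [Metric.tendsto_atTop]
  intro η hη
  have hβ : 0 < 1 - β := by linarith
  obtain ⟨N, hN⟩ := Metric.tendsto_atTop.1 hw ((1 - β) * (η / 2)) (by positivity)
  have hb : ∀ k, |u (N + k)| ≤ η / 2 + β ^ k * |u N| := by
    intro k
    induction k with
    | zero => simp; positivity
    | succ k ih =>
      have h1 := (hN (N + k) (by omega)).le
      rw [Real.dist_0_eq_abs] at h1
      rw [← add_assoc, hu]
      calc |β * u (N + k) + w (N + k)| ≤ β * |u (N + k)| + |w (N + k)| := by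
            refine (abs_add_le _ _).trans_eq ?_
            rw [abs_mul, abs_of_nonneg hβ0]
        _ ≤ β * (η / 2 + β ^ k * |u N|) + (1 - β) * (η / 2) := by gcongr
        _ = η / 2 + β ^ (k + 1) * |u N| := by ring
  have h2 : Tendsto (fun k => β ^ k * |u N|) atTop (𝓝 0) := by
    simpa using (tendsto_pow_atTop_nhds_zero_of_lt_one hβ0 hβ1).mul_const |u N|
  obtain ⟨k₀, hk₀⟩ := eventually_atTop.1 (h2.eventually (gt_mem_nhds (half_pos hη)))
  refine ⟨N + k₀, fun n hn => ?_⟩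
  have h3 := hk₀ (n - N) (by omega)
  have h4 := hb (n - N)
  rw [Nat.add_sub_cancel' (by omega)] at h4
  rw [Real.dist_0_eq_abs]
  linarith

theorem bddAbove_of_affine_recursion {β : ℝ} (hβ0 : 0 ≤ β) (hβ1 : β ≤ 1) {u w : ℕ → ℝ}
    (hu : ∀ n, u (n + 1) = β * u n + (1 - β) * w n) {B : ℝ} (hw : ∀ n, w n ≤ B) (n : ℕ) :
    u n ≤ max (u 0) B := by
  induction n with
  | zero => exact le_max_left _ _
  | succ n ih =>
    rw [hu]
    have h1 := mul_le_mul_of_nonneg_left ih hβ0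
    have h2 := mul_le_mul_of_nonneg_left ((hw n).trans (le_max_right (u 0) B)) (sub_nonneg.2 hβ1)
    linarith

variable {d : ℕ}

/-- The effective step size of the Adam recursion at step `n` in coordinate `i`. -/
noncomputable def adamStep (α β γ ε : ℝ) (M : ℕ → EuclideanSpace ℝ (Fin d)) (n : ℕ) (i : Fin d) :
    ℝ :=
  γ * (1 - α ^ n)⁻¹ * (ε + (√(1 - β ^ n))⁻¹ * √(M n i))⁻¹

section Step

variable {L : EuclideanSpace ℝ (Fin d) → ℝ} {α β γ ε : ℝ} {Θ m M : ℕ → EuclideanSpace ℝ (Fin d)}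

theorem IsAdamProcess.apply_succ (h : IsAdamProcess L α β γ ε Θ m M) (n : ℕ) (i : Fin d) :
    Θ (n + 1) i = Θ n i - adamStep α β γ ε M (n + 1) i * m (n + 1) i :=
  h.iterate n i

theorem adamStep_pos (hα : α ∈ Set.Ioo (0 : ℝ) 1) (hγ : 0 < γ) (hε : 0 < ε) {n : ℕ} (hn : n ≠ 0)
    (i : Fin d) : 0 < adamStep α β γ ε M n i := by
  have : 0 < 1 - α ^ n := sub_pos.2 (pow_lt_one₀ hα.1.le hα.2 hn)
  unfold adamStep
  positivity

/-- The factor α in the bound on γ absorbs the bias correction, since eventually 1 - α^n > α. -/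
theorem eventually_adamStep_le (hα : α ∈ Set.Ioo (0 : ℝ) 1) (hγ : 0 < γ) (hε : 0 < ε) {K : ℝ}
    (hK : 0 < K) (hγ_le : γ ≤ α * ε / K) :
    ∀ᶠ n in atTop, ∀ i, K * adamStep α β γ ε M n i ≤ 1 := by
  have h1 := (tendsto_pow_atTop_nhds_zero_of_lt_one hα.1.le hα.2).eventually
    (gt_mem_nhds (sub_pos.2 hα.2))
  filter_upwards [h1, eventually_ne_atTop 0] with n hn hn0 i
  have h2 : 0 < 1 - α ^ n := sub_pos.2 (pow_lt_one₀ hα.1.le hα.2 hn0)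
  have h3 : ε ≤ ε + (√(1 - β ^ n))⁻¹ * √(M n i) := le_add_of_nonneg_right (by positivity)
  rw [le_div_iff₀ hK] at hγ_le
  have h4 : adamStep α β γ ε M n i * ((1 - α ^ n) * (ε + (√(1 - β ^ n))⁻¹ * √(M n i))) = γ := by
    unfold adamStep
    field_simp
  have hp := adamStep_pos (β := β) (M := M) hα hγ hε hn0 i
  set D := adamStep α β γ ε M n i
  have h5 : D * (α * ε) ≤ γ := by
    rw [← h4]
    gcongr
    linarith
  have h6 : α * ε * (K * D) ≤ α * ε * 1 := by nlinarith
  exact le_of_mul_le_mul_left h6 (mul_pos hα.1 hε)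

/-- Since M (n+1) ≥ β M n, the root of M shrinks at most by √β > α; the strict gap absorbs the bias
correction for large n. -/
theorem IsAdamProcess.eventually_mul_adamStep_succ_le (h : IsAdamProcess L α β γ ε Θ m M)
    (hα : α ∈ Set.Ioo (0 : ℝ) 1) (hβ : β ∈ Set.Ioo (0 : ℝ) 1) (hγ : 0 < γ) (hε : 0 < ε)
    (hβα : β > α ^ 2) :
    ∀ᶠ n in atTop, ∀ i, α * adamStep α β γ ε M (n + 1) i ≤ adamStep α β γ ε M n i := by
  have h1 : Tendsto (fun n => β * (1 - β ^ n)) atTop (𝓝 β) := by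
    simpa using ((tendsto_pow_atTop_nhds_zero_of_lt_one hβ.1.le hβ.2).const_sub 1).const_mul β
  filter_upwards [h1.eventually (lt_mem_nhds hβα), eventually_ne_atTop 0] with n hn hn0 i
  have hα1 : 0 < 1 - α ^ n := sub_pos.2 (pow_lt_one₀ hα.1.le hα.2 hn0)
  have hα2 : 1 - α ^ n ≤ 1 - α ^ (n + 1) :=
    sub_le_sub_left (pow_le_pow_of_le_one hα.1.le hα.2.le n.le_succ) 1
  have hβ1 : 0 < 1 - β ^ n := sub_pos.2 (pow_lt_one₀ hβ.1.le hβ.2 hn0)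
  have hβ2 : 0 < 1 - β ^ (n + 1) := sub_pos.2 (pow_lt_one₀ hβ.1.le hβ.2 n.succ_ne_zero)
  have hM : √β * √(M n i) ≤ √(M (n + 1) i) := by
    rw [← Real.sqrt_mul hβ.1.le]
    refine Real.sqrt_le_sqrt ?_
    rw [h.second_moment]
    exact le_add_of_nonneg_right (mul_nonneg (sub_nonneg.2 hβ.2.le) (sq_nonneg _))
  have hs : α * √(1 - β ^ (n + 1)) ≤ √β * √(1 - β ^ n) := by
    rw [← Real.sqrt_mul hβ.1.le]
    refine Real.le_sqrt_of_sq_le ?_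
    rw [mul_pow, Real.sq_sqrt hβ2.le]
    nlinarith [pow_pos hβ.1 (n + 1), sq_nonneg α, mul_nonneg (sq_nonneg α) (pow_pos hβ.1 (n + 1)).le]
  have hv : α * ((√(1 - β ^ n))⁻¹ * √(M n i)) ≤ (√(1 - β ^ (n + 1)))⁻¹ * √(M (n + 1) i) := by
    have h3 := Real.sqrt_pos.2 hβ1
    have h4 := Real.sqrt_pos.2 hβ2
    rw [inv_mul_eq_div, inv_mul_eq_div, ← mul_div_assoc, div_le_div_iff₀ h3 h4]
    have h5 := mul_le_mul_of_nonneg_right hs (Real.sqrt_nonneg (M n i))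
    have h6 := mul_le_mul_of_nonneg_right hM h3.le
    linarith
  unfold adamStep
  set v := (√(1 - β ^ n))⁻¹ * √(M n i)
  set v' := (√(1 - β ^ (n + 1)))⁻¹ * √(M (n + 1) i)
  have hv0 : 0 ≤ v := by positivity
  have hv0' : 0 ≤ v' := by positivity
  have hα3 : 0 < 1 - α ^ (n + 1) := hα1.trans_le hα2
  have hkey : α * (ε + v) * (1 - α ^ n) ≤ (ε + v') * (1 - α ^ (n + 1)) := by
    refine mul_le_mul ?_ hα2 hα1.le (by positivity)
    nlinarith [mul_lt_mul_of_pos_right hα.2 hε]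
  rw [← div_eq_mul_inv, ← div_eq_mul_inv, ← div_eq_mul_inv, ← div_eq_mul_inv, div_div, div_div,
    ← mul_div_assoc, div_le_div_iff₀ (by positivity) (by positivity)]
  nlinarith [mul_le_mul_of_nonneg_left hkey hγ.le]

theorem IsAdamProcess.exists_pos_le_adamStep (h : IsAdamProcess L α β γ ε Θ m M)
    (hα : α ∈ Set.Ioo (0 : ℝ) 1) (hβ : β ∈ Set.Ioo (0 : ℝ) 1) (hγ : 0 < γ) (hε : 0 < ε) {i : Fin d}
    {G : ℝ} (hG : ∀ n, gradient L (Θ n) i ^ 2 ≤ G) :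
    ∃ ρ : ℝ, 0 < ρ ∧ ∀ n, n ≠ 0 → ρ ≤ adamStep α β γ ε M n i := by
  have hM := bddAbove_of_affine_recursion hβ.1.le hβ.2.le (u := fun n => M n i)
    (w := fun n => gradient L (Θ n) i ^ 2) (fun n => h.second_moment n i) hG
  have hb : 0 < √(1 - β) := Real.sqrt_pos.2 (sub_pos.2 hβ.2)
  refine ⟨γ * (ε + (√(1 - β))⁻¹ * √(max (M 0 i) G))⁻¹, by positivity, fun n hn => ?_⟩
  have hα1 : 0 < 1 - α ^ n := sub_pos.2 (pow_lt_one₀ hα.1.le hα.2 hn)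
  have h2 : 1 ≤ (1 - α ^ n)⁻¹ := (one_le_inv₀ hα1).2 (by linarith [pow_pos hα.1 n])
  have h3 : √(1 - β) ≤ √(1 - β ^ n) :=
    Real.sqrt_le_sqrt (sub_le_sub_left (pow_le_of_le_one hβ.1.le hβ.2.le hn) 1)
  unfold adamStep
  refine mul_le_mul (le_mul_of_one_le_right hγ.le h2) ?_ (by positivity) (by positivity)
  refine inv_anti₀ (by positivity) ?_
  gcongr
  exact hM n

theorem tendsto_adamStep (hα : α ∈ Set.Ioo (0 : ℝ) 1) (hβ : β ∈ Set.Ioo (0 : ℝ) 1) (hε : 0 < ε)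
    {i : Fin d} (hM : Tendsto (fun n => M n i) atTop (𝓝 0)) :
    Tendsto (fun n => adamStep α β γ ε M n i) atTop (𝓝 (γ * ε⁻¹)) := by
  have h1 := (tendsto_pow_atTop_nhds_zero_of_lt_one hα.1.le hα.2).const_sub 1
  have h2 := ((tendsto_pow_atTop_nhds_zero_of_lt_one hβ.1.le hβ.2).const_sub 1).sqrt
  have h3 := (h1.inv₀ (by norm_num)).const_mul γ
  have h4 := (((h2.inv₀ (by norm_num)).mul hM.sqrt).const_add ε).inv₀ (by simpa using hε.ne')
  unfold adamStep
  simpa using h3.mul h4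

/-- The kinetic part of the Lyapunov function of the Adam recursion. -/
noncomputable def adamKinetic (α β γ ε : ℝ) (m M : ℕ → EuclideanSpace ℝ (Fin d)) (n : ℕ) : ℝ :=
  ∑ i, adamStep α β γ ε M n i * m n i ^ 2

/-- Here p, q are consecutive momenta and D, D' the step sizes. Solving for g leaves the cross term
τ² D' p q, which Young's inequality splits using τ² D' ≤ D. The weight τ / (2(1 - τ²)) makes the
kinetic terms telescope; the surplus 1/(1+τ) - 1/2 is positive because τ < 1. -/
theorem coordinate_energy_le {τ : ℝ} (hτ : τ ∈ Set.Ioo (0 : ℝ) 1) {K D D' g p q : ℝ}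
    (hD' : 0 ≤ D') (hD : τ ^ 2 * D' ≤ D) (hKD : K * D' ≤ 1)
    (hq : q = τ ^ 2 * p + (1 - τ ^ 2) * g) :
    g * (-(D' * q)) + K / 2 * (D' * q) ^ 2 ≤
      τ / (2 * (1 - τ ^ 2)) * (D * p ^ 2)
        - (τ / (2 * (1 - τ ^ 2)) + (1 / (1 + τ) - 1 / 2)) * (D' * q ^ 2) := by
  obtain ⟨h0, h1⟩ := hτ
  have hs : 0 < 1 - τ ^ 2 := by nlinarith
  have hg : g = (q - τ ^ 2 * p) / (1 - τ ^ 2) := by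
    rw [hq]; field_simp; ring
  have e1 : K / 2 * (D' * q) ^ 2 ≤ 1 / 2 * (D' * q ^ 2) := by
    have := mul_le_mul_of_nonneg_right hKD (mul_nonneg hD' (sq_nonneg q))
    nlinarith
  have e2 : τ ^ 2 * p * (D' * q) ≤ τ / 2 * (D * p ^ 2) + τ / 2 * (D' * q ^ 2) := by
    have a1 := mul_le_mul_of_nonneg_right hD (mul_nonneg h0.le (sq_nonneg p))
    have a2 := mul_nonneg (mul_nonneg h0.le hD') (sq_nonneg (τ * p - q))
    nlinarith
  have e3 : 1 / (1 + τ) = (1 - τ) / (1 - τ ^ 2) := by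
    rw [div_eq_div_iff (by positivity) hs.ne']; ring
  have e4 : g * (-(D' * q)) ≤
      (τ / 2 * (D * p ^ 2) + τ / 2 * (D' * q ^ 2) - D' * q ^ 2) / (1 - τ ^ 2) := by
    rw [hg, div_mul_eq_mul_div, div_le_div_iff_of_pos_right hs]
    nlinarith
  rw [e3]
  refine (add_le_add e4 e1).trans_eq ?_
  field_simp
  ring

theorem IsAdamProcess.energy_succ_le (h : IsAdamProcess L α β γ ε Θ m M)
    (hL : Differentiable ℝ L) {K : ℝ}
    (hLip : ∀ x y, ‖gradient L x - gradient L y‖ ≤ K * ‖x - y‖)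
    {τ : ℝ} (hτ : τ ∈ Set.Ioo (0 : ℝ) 1) (hα : α = τ ^ 2) (hγ : 0 < γ) (hε : 0 < ε) {n : ℕ}
    (hK : ∀ i, K * adamStep α β γ ε M (n + 1) i ≤ 1)
    (hstep : ∀ i, α * adamStep α β γ ε M (n + 1) i ≤ adamStep α β γ ε M n i) :
    L (Θ (n + 1)) + τ / (2 * (1 - τ ^ 2)) * adamKinetic α β γ ε m M (n + 1)
        + (1 / (1 + τ) - 1 / 2) * adamKinetic α β γ ε m M (n + 1)
      ≤ L (Θ n) + τ / (2 * (1 - τ ^ 2)) * adamKinetic α β γ ε m M n := by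
  have hα' : α ∈ Set.Ioo (0 : ℝ) 1 := by
    rw [hα]; exact ⟨pow_pos hτ.1 2, pow_lt_one₀ hτ.1.le hτ.2 two_ne_zero⟩
  have h1 := le_add_inner_gradient_add_sq hL hLip (Θ n) (Θ (n + 1) - Θ n)
  rw [add_sub_cancel] at h1
  have h2 : inner ℝ (gradient L (Θ n)) (Θ (n + 1) - Θ n) + K / 2 * ‖Θ (n + 1) - Θ n‖ ^ 2 ≤
      τ / (2 * (1 - τ ^ 2)) * adamKinetic α β γ ε m M n
        - (τ / (2 * (1 - τ ^ 2)) + (1 / (1 + τ) - 1 / 2)) * adamKinetic α β γ ε m M (n + 1) := by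
    unfold adamKinetic
    rw [PiLp.inner_apply, EuclideanSpace.real_norm_sq_eq, Finset.mul_sum, Finset.mul_sum,
      Finset.mul_sum, ← Finset.sum_add_distrib, ← Finset.sum_sub_distrib]
    refine Finset.sum_le_sum fun i _ => ?_
    have hm : m (n + 1) i = τ ^ 2 * m n i + (1 - τ ^ 2) * gradient L (Θ n) i := by
      rw [h.first_moment, hα]; simp
    have := coordinate_energy_le hτ (D := adamStep α β γ ε M n i)
      (adamStep_pos (β := β) (M := M) hα' hγ hε n.succ_ne_zero i).le
      ((congrArg (· * _) hα).symm.trans_le (hstep i)) (hK i) hm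
    refine le_trans (le_of_eq ?_) this
    have hd : (Θ (n + 1) - Θ n) i = -(adamStep α β γ ε M (n + 1) i * m (n + 1) i) := by
      rw [PiLp.sub_apply, h.apply_succ]; ring
    rw [hd]
    simp only [RCLike.inner_apply, conj_trivial, neg_sq]
    ring
  linarith

end Step

end Adam

/-! ### Convergence to the minimizer and reduction to heavy ball. -/

section Adam

open Filter Topology

variable {d : ℕ} {L : EuclideanSpace ℝ (Fin d) → ℝ} {α β γ ε : ℝ}
  {Θ m M : ℕ → EuclideanSpace ℝ (Fin d)}

theorem tendsto_zero_of_add_le {F S : ℕ → ℝ} {b c : ℝ} (hb : 0 < b)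
    (hF : ∀ n, c ≤ F n) (h : ∀ n, F (n + 1) + b * S (n + 1) ≤ F n) (hS0 : ∀ n, 0 ≤ S (n + 1)) :
    Tendsto S atTop (𝓝 0) := by
  have hanti : Antitone F := antitone_nat_of_succ_le fun n => by
    linarith [h n, mul_nonneg hb.le (hS0 n)]
  have hlim := tendsto_atTop_ciInf hanti ⟨c, by rintro _ ⟨n, rfl⟩; exact hF n⟩
  rw [← tendsto_add_atTop_iff_nat 1]
  have h1 := (hlim.sub (hlim.comp (tendsto_add_atTop_nat 1))).div_const b
  rw [sub_self, zero_div] at h1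
  refine squeeze_zero hS0 (fun n => ?_) h1
  rw [le_div_iff₀ hb]
  simp only [Function.comp_apply]
  linarith [h n]

/-- Lyapunov decrease makes the kinetic term vanish and bounds the iterates. Bounded gradients keep
the step sizes away from 0, so `m` tends to 0, then the gradients, then `Θ` by coercivity. -/
theorem IsAdamProcess.tendsto_zero (h : IsAdamProcess L α β γ ε Θ m M)
    (hL : ContDiff ℝ 2 L) {κ K : ℝ} (hκ : 0 < κ) (hK : 0 < K)
    (hLip : ∀ x y, ‖gradient L x - gradient L y‖ ≤ K * ‖x - y‖)
    (hcoer : ∀ x, inner ℝ x (gradient L x) ≥ κ * ‖x‖ ^ 2)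
    (hα : α ∈ Set.Ioo (0 : ℝ) 1) (hβ : β ∈ Set.Ioo (0 : ℝ) 1) (hγ : 0 < γ) (hε : 0 < ε)
    (hβα : β > α ^ 2) (hγ_le : γ ≤ α * ε / K) :
    Tendsto Θ atTop (𝓝 0) := by
  have hdiff : Differentiable ℝ L := hL.differentiable (by norm_num)
  have hg0 := gradient_zero_of_inner_gradient_ge hL hcoer
  have hgK : ∀ x, ‖gradient L x‖ ≤ K * ‖x‖ := fun x => by simpa [hg0] using hLip x 0
  have hτ : √α ∈ Set.Ioo (0 : ℝ) 1 :=
    ⟨Real.sqrt_pos.2 hα.1, (Real.sqrt_lt' one_pos).2 (by simpa using hα.2)⟩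
  have hατ : α = √α ^ 2 := (Real.sq_sqrt hα.1.le).symm
  set a := √α / (2 * (1 - √α ^ 2)) with ha
  set b := 1 / (1 + √α) - 1 / 2 with hb
  have ha0 : 0 ≤ a := by
    have : 0 < 1 - √α ^ 2 := by rw [← hατ]; exact sub_pos.2 hα.2
    have := hτ.1
    positivity
  have hb0 : 0 < b := sub_pos.2 (one_div_lt_one_div_of_lt (by linarith [hτ.1]) (by linarith [hτ.2]))
  set S := adamKinetic α β γ ε m M with hS
  have hterm : ∀ n, n ≠ 0 → ∀ i, 0 ≤ adamStep α β γ ε M n i * m n i ^ 2 := fun n hn i =>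
    mul_nonneg (adamStep_pos hα hγ hε hn i).le (sq_nonneg _)
  have hS0 : ∀ n, n ≠ 0 → 0 ≤ S n := fun n hn => Finset.sum_nonneg fun i _ => hterm n hn i
  obtain ⟨N, hN⟩ := eventually_atTop.1
    ((((tendsto_add_atTop_nat 1).eventually
      (eventually_adamStep_le (β := β) (M := M) hα hγ hε hK hγ_le)).and
      (h.eventually_mul_adamStep_succ_le hα hβ hγ hε hβα)).and (eventually_ne_atTop 0))
  -- The shift by N is needed because the step size bounds hold only eventually.
  set F : ℕ → ℝ := fun k => L (Θ (k + N)) + a * S (k + N) with hF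
  have hFstep : ∀ k, F (k + 1) + b * S (k + 1 + N) ≤ F k := fun k => by
    have hk := hN (k + N) (by omega)
    have := h.energy_succ_le hdiff hLip hτ hατ hγ hε hk.1.1 hk.1.2
    simp only [hF]
    rw [add_right_comm k 1 N]
    exact this
  have hFlow : ∀ k, L 0 + κ / 2 * ‖Θ (k + N)‖ ^ 2 ≤ F k := fun k =>
    (add_sq_le_of_inner_gradient_ge hdiff hcoer _).trans
      (le_add_of_nonneg_right (mul_nonneg ha0 (hS0 _ (hN _ (by omega)).2)))
  have hSlim : Tendsto S atTop (𝓝 0) := by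
    rw [← tendsto_add_atTop_iff_nat N]
    exact tendsto_zero_of_add_le hb0
      (fun k => le_trans (le_add_of_nonneg_right (by positivity)) (hFlow k)) hFstep
      (fun k => hS0 _ (by omega))
  have hFanti : Antitone F := antitone_nat_of_succ_le fun k =>
    (le_add_of_nonneg_right (mul_nonneg hb0.le (hS0 _ (by omega)))).trans (hFstep k)
  have hbdd : ∀ i, ∃ G, ∀ n, gradient L (Θ n) i ^ 2 ≤ G := fun i => by
    have : IsBoundedUnder (· ≤ ·) atTop fun n => gradient L (Θ n) i ^ 2 := by
      refine isBoundedUnder_of_eventually_le (a := K ^ 2 * ((F 0 - L 0) / (κ / 2))) ?_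
      filter_upwards [eventually_ge_atTop N] with n hn
      have h1 := hFlow (n - N)
      have h2 := hFanti (Nat.zero_le (n - N))
      rw [Nat.sub_add_cancel hn] at h1
      have h3 : ‖Θ n‖ ^ 2 ≤ (F 0 - L 0) / (κ / 2) := by
        rw [le_div_iff₀ (by positivity)]; linarith
      calc gradient L (Θ n) i ^ 2 ≤ (K * ‖Θ n‖) ^ 2 := by
            rw [← sq_abs]
            exact pow_le_pow_left₀ (abs_nonneg _) ((PiLp.norm_apply_le _ i).trans (hgK _)) 2
        _ = K ^ 2 * ‖Θ n‖ ^ 2 := mul_pow _ _ _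
        _ ≤ _ := by gcongr
    obtain ⟨G, hG⟩ := this.bddAbove_range
    exact ⟨G, fun n => hG ⟨n, rfl⟩⟩
  have hm : ∀ i, Tendsto (fun n => m n i) atTop (𝓝 0) := fun i => by
    obtain ⟨G, hG⟩ := hbdd i
    obtain ⟨ρ, hρ, hρle⟩ := h.exists_pos_le_adamStep hα hβ hγ hε hG
    have h1 : Tendsto (fun n => m n i ^ 2) atTop (𝓝 0) := by
      have h2 := hSlim.div_const ρ
      rw [zero_div] at h2
      refine squeeze_zero' (Eventually.of_forall fun n => sq_nonneg _) ?_ h2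
      filter_upwards [eventually_ne_atTop 0] with n hn
      rw [le_div_iff₀ hρ, mul_comm]
      exact (mul_le_mul_of_nonneg_right (hρle n hn) (sq_nonneg _)).trans
        (Finset.single_le_sum (fun j _ => hterm n hn j) (Finset.mem_univ i))
    simpa [Real.sqrt_sq_eq_abs, tendsto_zero_iff_abs_tendsto_zero, Function.comp_def] using h1.sqrt
  have hg : ∀ i, Tendsto (fun n => gradient L (Θ n) i) atTop (𝓝 0) := fun i => by
    -- The momentum recursion, solved for the gradient.
    have h1 := ((((hm i).comp (tendsto_add_atTop_nat 1)).sub ((hm i).const_mul α)).div_const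
      (1 - α))
    rw [mul_zero, sub_zero, zero_div] at h1
    refine h1.congr fun n => ?_
    have h2 : 1 - α ≠ 0 := (sub_pos.2 hα.2).ne'
    simp only [Function.comp_apply, h.first_moment]
    simp
    field_simp
  have hgn : Tendsto (fun n => ‖gradient L (Θ n)‖ ^ 2) atTop (𝓝 0) := by
    simp only [EuclideanSpace.real_norm_sq_eq]
    simpa using tendsto_finsetSum Finset.univ fun i _ => (hg i).pow 2
  have hgn' : Tendsto (fun n => ‖gradient L (Θ n)‖ / κ) atTop (𝓝 0) := by
    simpa [Real.sqrt_sq] using hgn.sqrt.div_const κ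
  refine squeeze_zero_norm (fun n => ?_) hgn'
  rw [le_div_iff₀ hκ, mul_comm]
  exact mul_norm_le_norm_gradient hcoer _

/-- Expressing m (n+1) through Θ n - Θ (n+1) isolates three errors: variation of the step size, its
distance to c, and linearization of the gradient. -/
theorem IsAdamProcess.momentum_defect_apply (h : IsAdamProcess L α β γ ε Θ m M)
    (H : EuclideanSpace ℝ (Fin d) →L[ℝ] EuclideanSpace ℝ (Fin d)) {n : ℕ} {i : Fin d} (c : ℝ)
    (hD : adamStep α β γ ε M (n + 1) i ≠ 0) :
    (Θ (n + 2) - (((1 + α) • Θ (n + 1) - ((1 - α) * c) • H (Θ (n + 1))) - α • Θ n)) i =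
      α * (1 - adamStep α β γ ε M (n + 2) i / adamStep α β γ ε M (n + 1) i)
          * (Θ n - Θ (n + 1)) i
        - (1 - α) * (adamStep α β γ ε M (n + 2) i - c) * gradient L (Θ (n + 1)) i
        - (1 - α) * c * (gradient L (Θ (n + 1)) - H (Θ (n + 1))) i := by
  have h1 := h.apply_succ n i
  have h2 := h.apply_succ (n + 1) i
  have h3 : m (n + 2) i = α * m (n + 1) i + (1 - α) * gradient L (Θ (n + 1)) i := by
    rw [h.first_moment]; simp
  have h4 : m (n + 1) i = (Θ n i - Θ (n + 1) i) / adamStep α β γ ε M (n + 1) i := by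
    rw [eq_div_iff hD]; linarith
  simp only [PiLp.sub_apply, PiLp.smul_apply, smul_eq_mul]
  rw [h2, h3, h4]
  field_simp
  ring

theorem IsAdamProcess.momentum_defect_isLittleO (h : IsAdamProcess L α β γ ε Θ m M)
    {K : ℝ} (hgK : ∀ x, ‖gradient L x‖ ≤ K * ‖x‖)
    {H : EuclideanSpace ℝ (Fin d) →L[ℝ] EuclideanSpace ℝ (Fin d)}
    (hH : HasFDerivAt (gradient L) H 0) (hΘ : Tendsto Θ atTop (𝓝 0))
    (hα : α ∈ Set.Ioo (0 : ℝ) 1) (hβ : β ∈ Set.Ioo (0 : ℝ) 1) (hγ : 0 < γ) (hε : 0 < ε) :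
    (fun n => Θ (n + 2) - (((1 + α) • Θ (n + 1) - ((1 - α) * (γ * ε⁻¹)) • H (Θ (n + 1)))
      - α • Θ n)) =o[atTop] fun n => ‖Θ (n + 1)‖ + ‖Θ n‖ := by
  have hg0 : gradient L 0 = 0 := norm_le_zero_iff.1 (by simpa using hgK 0)
  have hM : ∀ i, Tendsto (fun n => M n i) atTop (𝓝 0) := fun i => by
    refine tendsto_zero_of_affine_recursion hβ.1.le hβ.2 (fun n => h.second_moment n i) ?_
    have h1 : Tendsto (fun n => gradient L (Θ n) i) atTop (𝓝 0) := by
      have h2 := hΘ.norm.const_mul K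
      rw [norm_zero, mul_zero] at h2
      exact squeeze_zero_norm (fun n => (PiLp.norm_apply_le _ i).trans (hgK _)) h2
    simpa using (h1.pow 2).const_mul (1 - β)
  have hx1 : (fun n => Θ (n + 1)) =O[atTop] fun n => ‖Θ (n + 1)‖ + ‖Θ n‖ :=
    Asymptotics.IsBigO.of_bound' (Eventually.of_forall fun n => by
      rw [Real.norm_of_nonneg (by positivity)]; exact le_add_of_nonneg_right (norm_nonneg _))
  have hx0 : Θ =O[atTop] fun n => ‖Θ (n + 1)‖ + ‖Θ n‖ :=
    Asymptotics.IsBigO.of_bound' (Eventually.of_forall fun n => by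
      rw [Real.norm_of_nonneg (by positivity)]; exact le_add_of_nonneg_left (norm_nonneg _))
  have happ : ∀ (i : Fin d) (f : ℕ → EuclideanSpace ℝ (Fin d)), (fun n => f n i) =O[atTop] f :=
    fun i f => Asymptotics.IsBigO.of_bound' (Eventually.of_forall fun n => PiLp.norm_apply_le _ i)
  have hΘ1 : Tendsto (fun n => Θ (n + 1)) atTop (𝓝 0) := hΘ.comp (tendsto_add_atTop_nat 1)
  have hg : (fun n => gradient L (Θ (n + 1))) =O[atTop] fun n => Θ (n + 1) :=
    Asymptotics.IsBigO.of_bound K (Eventually.of_forall fun n => hgK _)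
  have hgH : (fun n => gradient L (Θ (n + 1)) - H (Θ (n + 1))) =o[atTop] fun n => Θ (n + 1) := by
    simpa [hg0, Function.comp_def] using hH.isLittleO.comp_tendsto hΘ1
  have hc : γ * ε⁻¹ ≠ 0 := by positivity
  have hcoord : ∀ i, (fun n => (Θ (n + 2) - (((1 + α) • Θ (n + 1)
      - ((1 - α) * (γ * ε⁻¹)) • H (Θ (n + 1))) - α • Θ n)) i)
      =o[atTop] fun n => ‖Θ (n + 1)‖ + ‖Θ n‖ := fun i => by
    have hD := tendsto_adamStep (γ := γ) hα hβ hε (hM i)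
    have hD1 := hD.comp (tendsto_add_atTop_nat 1)
    have hD2 := hD.comp (tendsto_add_atTop_nat 2)
    have t1 : Tendsto (fun n => α * (1 - adamStep α β γ ε M (n + 2) i
        / adamStep α β γ ε M (n + 1) i)) atTop (𝓝 0) := by
      simpa [div_self hc, Function.comp_def] using ((hD2.div hD1 hc).const_sub 1).const_mul α
    have t2 : Tendsto (fun n => (1 - α) * (adamStep α β γ ε M (n + 2) i - γ * ε⁻¹))
        atTop (𝓝 0) := by
      simpa [Function.comp_def] using (hD2.sub_const (γ * ε⁻¹)).const_mul (1 - α)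
    have o1 := ((Asymptotics.isLittleO_one_iff ℝ).2 t1).mul_isBigO
      ((happ i _).trans (hx0.sub hx1))
    have o2 := ((Asymptotics.isLittleO_one_iff ℝ).2 t2).mul_isBigO
      ((happ i _).trans (hg.trans hx1))
    have o3 := (((happ i _).trans_isLittleO hgH).trans_isBigO hx1).const_mul_left
      ((1 - α) * (γ * ε⁻¹))
    simp only [one_mul] at o1 o2
    refine ((o1.sub o2).sub o3).congr_left fun n => ?_
    exact (h.momentum_defect_apply H _ (adamStep_pos hα hγ hε n.succ_ne_zero i).ne').symm
  exact ((PiLp.continuousLinearEquiv 2 ℝ fun _ : Fin d => ℝ).symm :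
    _ →L[ℝ] EuclideanSpace ℝ (Fin d)).isBigO_comp _ _ |>.trans_isLittleO
      (Asymptotics.isLittleO_pi.2 hcoord)

theorem coercivity_le_lipschitz {E : Type*} [NormedAddCommGroup E] [InnerProductSpace ℝ E]
    {g : E → E} {κ K : ℝ} (hgK : ∀ x, ‖g x‖ ≤ K * ‖x‖)
    (hcoer : ∀ x, inner ℝ x (g x) ≥ κ * ‖x‖ ^ 2) {v : E} (hv : v ≠ 0) : κ ≤ K := by
  have hv' := norm_pos_iff.2 hv
  have h1 := (hcoer v).le.trans (real_inner_le_norm _ _)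
  have h2 := mul_le_mul_of_nonneg_left (hgK v) hv'.le
  exact le_of_mul_le_mul_right (by nlinarith) (pow_pos hv' 2)

/-- With τ = √α, the upper bound 2τ reduces to (1-τ)² ≤ (1-τ²) c λ for the eigenvalues λ of H, with
equality at λ = κ by the choice of α. The lower bound -2τ follows from c λ ≤ 1. -/
theorem abs_inner_momentum_le {E : Type*} [NormedAddCommGroup E] [InnerProductSpace ℝ E]
    {H : E →L[ℝ] E} {κ c : ℝ} (hc : 0 < c * κ) (hc1 : c * κ < 1) (hc0 : 0 ≤ c) {α : ℝ}
    (hα : α = ((1 - c * κ) / (1 + c * κ)) ^ 2) (hα1 : α ≤ 1)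
    (hlow : ∀ v, κ * ‖v‖ ^ 2 ≤ inner ℝ v (H v))
    (hup : ∀ v, c * inner ℝ v (H v) ≤ ‖v‖ ^ 2) (v : E) :
    |inner ℝ ((1 + α) • v - ((1 - α) * c) • H v) v| ≤ 2 * √α * ‖v‖ ^ 2 := by
  set τ := (1 - c * κ) / (1 + c * κ) with hτ
  have hτ0 : 0 ≤ τ := div_nonneg (by linarith) (by linarith)
  rw [hα, Real.sqrt_sq hτ0, inner_sub_left, inner_smul_left, inner_smul_left,
    real_inner_self_eq_norm_sq, real_inner_comm]
  simp only [conj_trivial]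
  have e : (1 - τ ^ 2) * (c * κ) = (1 - τ) ^ 2 := by
    rw [hτ]; field_simp; ring
  have h1 := mul_le_mul_of_nonneg_left (hlow v) hc0
  have h2 : 0 ≤ 1 - τ ^ 2 := by linarith
  have h3 := mul_le_mul_of_nonneg_left h1 h2
  have h4 := mul_le_mul_of_nonneg_left (hup v) h2
  have h5 := congrArg (· * ‖v‖ ^ 2) e
  have h6 := mul_nonneg hτ0 (sq_nonneg ‖v‖)
  have h7 := mul_nonneg (sq_nonneg τ) (sq_nonneg ‖v‖)
  rw [abs_le]
  constructor <;> nlinarith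

end Adam

theorem corollary4p4 (d : ℕ) (κ K : ℝ) (hκ : 0 < κ) (hK : 0 < K)
    (L : EuclideanSpace ℝ (Fin d) → ℝ) (hL : ContDiff ℝ 2 L)
    (hLip : ∀ θ ψ : EuclideanSpace ℝ (Fin d),
      ‖gradient L θ - gradient L ψ‖ ≤ K * ‖θ - ψ‖)
    (hcoer : ∀ θ : EuclideanSpace ℝ (Fin d), inner ℝ θ (gradient L θ) ≥ κ * ‖θ‖ ^ 2)
    (α β γ ε : ℝ) (hα : α ∈ Set.Ioo (0 : ℝ) 1) (hβ : β ∈ Set.Ioo (0 : ℝ) 1)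
    (hγ : 0 < γ) (hε : 0 < ε)
    (hα_eq : α = ((1 - γ * ε⁻¹ * κ) / (1 + γ * ε⁻¹ * κ)) ^ 2)
    (hβα : β > α ^ 2) (hγ_le : γ ≤ α * ε / K)
    (Θ m M : ℕ → EuclideanSpace ℝ (Fin d))
    (hAdam : IsAdamProcess L α β γ ε Θ m M) :
    ∀ δ : ℝ, 0 < δ → ∃ C : ℝ, 0 < C ∧
      ∀ n : ℕ, 1 ≤ n → ‖Θ n‖ ≤ C * (√α + δ) ^ n := by
  intro δ hδ
  -- The comparison κ ≤ K below needs a nonzero vector, so dimension 0 is treated apart.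
  rcases subsingleton_or_nontrivial (EuclideanSpace ℝ (Fin d)) with _ | _
  · refine ⟨1, one_pos, fun n _ => ?_⟩
    rw [Subsingleton.elim (Θ n) 0, norm_zero]
    positivity
  obtain ⟨w, hw⟩ := exists_ne (0 : EuclideanSpace ℝ (Fin d))
  have hg0 := gradient_zero_of_inner_gradient_ge hL hcoer
  have hgK : ∀ x, ‖gradient L x‖ ≤ K * ‖x‖ := fun x => by simpa [hg0] using hLip x 0
  have hκK := coercivity_le_lipschitz hgK hcoer hw
  have hc : 0 < γ * ε⁻¹ := by positivity
  have hcK : γ * ε⁻¹ * K ≤ α := by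
    rw [le_div_iff₀ hK] at hγ_le
    rw [mul_right_comm, ← div_eq_mul_inv, div_le_iff₀ hε]
    exact hγ_le
  obtain ⟨H, hH, hHsymm⟩ := exists_symmetric_hasFDerivAt_gradient hL 0
  have hHK : ∀ v, ‖H v‖ ≤ K * ‖v‖ := fun v =>
    H.le_of_opNorm_le (hH.le_of_lip' hK.le (Filter.Eventually.of_forall fun x => hLip x 0)) v
  -- The chain cκ ≤ cK ≤ α < 1 ensures that √α is (1 - cκ)/(1 + cκ) without a sign change.
  have hPb := abs_inner_momentum_le (mul_pos hc hκ)
    (((mul_le_mul_of_nonneg_left hκK hc.le).trans hcK).trans_lt hα.2) hc.le hα_eq hα.2.le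
    (mul_sq_le_inner_of_hasFDerivAt hH hg0 hcoer) (fun v => by
      have h1 := (real_inner_le_norm v (H v)).trans
        (mul_le_mul_of_nonneg_left (hHK v) (norm_nonneg v))
      calc γ * ε⁻¹ * inner ℝ v (H v) ≤ γ * ε⁻¹ * (‖v‖ * (K * ‖v‖)) := by gcongr
        _ = γ * ε⁻¹ * K * ‖v‖ ^ 2 := by ring
        _ ≤ 1 * ‖v‖ ^ 2 := by gcongr; exact hcK.trans hα.2.le
        _ = ‖v‖ ^ 2 := one_mul _)
  have hΘ := hAdam.tendsto_zero hL hκ hK hLip hcoer hα hβ hγ hε hβα hγ_le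
  have ho := hAdam.momentum_defect_isLittleO hgK hH hΘ hα hβ hγ hε
  obtain ⟨P, hP⟩ : ∃ P : EuclideanSpace ℝ (Fin d) →L[ℝ] EuclideanSpace ℝ (Fin d),
      ∀ v, P v = (1 + α) • v - ((1 - α) * (γ * ε⁻¹)) • H v :=
    ⟨(1 + α) • ContinuousLinearMap.id ℝ _ - ((1 - α) * (γ * ε⁻¹)) • H, fun v => rfl⟩
  simp only [← hP] at hPb ho
  have hPsymm : ∀ v w, inner ℝ (P v) w = inner ℝ v (P w) := fun v w => by
    simp only [hP, inner_sub_left, inner_sub_right, inner_smul_left, inner_smul_right, hHsymm,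
      conj_trivial]
  obtain ⟨C, hC, hbound⟩ := exists_norm_le_pow_of_momentum_recursion (x := Θ)
    (Real.sqrt_pos.2 hα.1) hPsymm hPb (fun η hη => by
      filter_upwards [ho.bound hη] with n hn
      rw [Real.norm_of_nonneg (by positivity)] at hn
      rwa [Real.sq_sqrt hα.1.le]) hδ
  exact ⟨C, hC, fun n _ => hbound n⟩
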